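/- Let $p$ be a prime. All rings are associative and unital. For a ring $A$ let $[A,A]$ be the additive subgroup generated by commutators and, for $a_0,a_1,\dots\in A$, let $\omega_i(a)=a_0^{p^i}+p\,a_1^{p^{i-1}}+\dots+p^i a_i$. Let $F=\mathbb Z\{A\}\to A$ be the canonical surjection from the free ring on the set $A$, let $W_n(F)\subset (F/[F,F])^n$ be the group generated by the ghost vectors $\omega(x)=(\omega_0(x),\dots,\omega_{n-1}(x))$, $x\in F^n$, and let $W_n(A)$ be the quotient of $W_n(F)$ by the subgroup generated by all $\omega(x)-\omega(y)$, where $x,y\in F^n$ have the same image in $A^n$. Let $W(A)=\varprojlim_n W_n(A)$ with the inverse limit topology of the discrete groups $W_n(A)$ (Hesselholt's group of $p$-typical Witt vectors), and let $q\colon A^{\mathbb N_0}\to W(A)$ send a sequence to the class of the ghost vectors of any lift of it to $F$. For a ring $R$ give $R^{\mathbb N_0}$ the product topology ($R$ discrete), put $V(a_0,a_1,\dots)=p\,(0,a_0,a_1,\dots)$ and $\langle a\rangle=(a,a^p,a^{p^2},\dots)$. Let $X(R)\subset R^{\mathbb N_0}$ be the closed subgroup (a subring) generated by all $V^m(\langle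 a_1\rangle\cdots\langle a_r\rangle)$ with $m\ge 0$, $r\ge1$, $a_i\in R$; for a two-sided ideal $I\subset R$ let $X(I)$ be the closed subgroup generated by those $V^m(\langle a_1\rangle\cdots\langle a_r\rangle)$ with at least one $a_i\in I$ (the smallest closed $V$-stable two-sided ideal of $X(R)$ containing $\langle a\rangle$ for all $a\in I$). Let $\mathbb ZA$ be the monoid ring of the multiplicative monoid of $A$ and $I=\ker(\mathbb ZA\to A)$. Let $E(A)=X(\mathbb ZA)/X(I)$ (the ring of Cuntz and Deninger), with the induced operator $V$, the map $\langle a\rangle=\langle [a]\rangle \bmod X(I)$ and the quotient topology, and let $HH_0(E(A))=E(A)/\overline{[E(A),E(A)]}$ with the quotient topology. For commutative $A$, the group $W(A)$ is the classical group of $p$-typical Witt vectors, $HH_0(E(A))=E(A)$, and there is a natural isomorphism $W(A)\to HH_0(E(A))$, $q(a_0,a_1,\dots)\mapsto\sum_{n\ge0}V^n\langle a_n\rangle$. **Theorem.** There is no natural transformation $\varphi_A\colon W(A)\to HH_0(E(A))$ between the functors $A\mapsto W(A)$ and $A\mapsto HH_0(E(A))$ on the category of rings such that every $\varphi_A$ is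 a continuous surjective group homomorphism and such that, for every commutative ring $A$, $\varphi_A$ is the natural isomorphism above, i.e. $\varphi_A(q(a_0,a_1,\dots))=\sum_{n\ge 0}V^n\langle a_n\rangle$ for all $a_0,a_1,\dots\in A$. -/

import Mathlib

open Topology

universe u

noncomputable section

namespace NCWitt

/-! ### The abelian group `R / [R, R]` -/

/-- The additive subgroup `[R, R]` generated by all commutators `x y - y x`. -/
def commutators (R : Type u) [Ring R] : AddSubgroup R :=
  AddSubgroup.closure (Set.range fun z : R × R => z.1 * z.2 - z.2 * z.1)

/-- The group `R / [R, R]`. -/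
abbrev ModComm (R : Type u) [Ring R] : Type u := R ⧸ commutators R

theorem commutators_le_comap {R S : Type u} [Ring R] [Ring S] (f : R →+* S) :
    commutators R ≤ (commutators S).comap f.toAddMonoidHom := by
  refine (AddSubgroup.closure_le _).2 ?_
  rintro _ ⟨⟨x, y⟩, rfl⟩
  exact AddSubgroup.subset_closure ⟨(f x, f y), by simp⟩

/-- The map `R / [R, R] → S / [S, S]` induced by a ring homomorphism. -/
def ModComm.map {R S : Type u} [Ring R] [Ring S] (f : R →+* S) : ModComm R →+ ModComm S :=
  QuotientAddGroup.map _ _ f.toAddMonoidHom (commutators_le_comap f)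

/-! ### The group `W(A)` of `p`-typical Witt vectors of a noncommutative ring

For a ring `A` let `π : F → A` be the canonical surjection from the free ring
`F = ℤ{A}` on the set `A`.  The group `F / [F, F]` is torsion free, and `W_n(F)` is the
group formed by the ghost vectors of elements of `F ^ n` inside `(F / [F, F]) ^ n`.  The group
`W_n(A)` is the quotient of `W_n(F)` obtained by identifying the classes of any two vectors
of `F ^ n` that have the same image in `A ^ n`, so that one has a map of sets
`A ^ n → W_n(A)` through which the ghost map factors.  Finally `W(A) = lim W_n(A)`. -/

/-- The ghost polynomial `a₀ ^ (p ^ n) + p a₁ ^ (p ^ (n - 1)) + ⋯ + p ^ n aₙ`. -/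
def ghost (p : ℕ) {R : Type u} [Ring R] (n : ℕ) (a : ℕ → R) : R :=
  ∑ i ∈ Finset.range (n + 1), (p : R) ^ i * a i ^ p ^ (n - i)

/-- The ghost map of length `n`, with values in `(R / [R, R]) ^ n`.  It involves only the
coordinates `a₀, …, aₙ₋₁` of the sequence `a`. -/
def ghostVec (p : ℕ) {R : Type u} [Ring R] (n : ℕ) (a : ℕ → R) : Fin n → ModComm R :=
  fun i => QuotientAddGroup.mk (ghost p i a)

/-- The canonical surjection `ℤ{A} → A`. -/
def freeProj (A : Type u) [Ring A] : FreeRing A →+* A := FreeRing.lift id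

theorem freeProj_map {A B : Type u} [Ring A] [Ring B] (f : A →+* B) (x : FreeRing A) :
    freeProj B (FreeRing.map f x) = f (freeProj A x) := by
  have h : (freeProj B).comp (FreeRing.map f) = f.comp (freeProj A) := by
    ext a
    simp [freeProj]
  exact congrArg (fun g : FreeRing A →+* B => g x) h

/-- `W_n` of the free ring on `A`, the group of ghost vectors. -/
def WFree (p : ℕ) (A : Type u) [Ring A] (n : ℕ) : AddSubgroup (Fin n → ModComm (FreeRing A)) :=
  AddSubgroup.closure (Set.range (ghostVec p n))

/-- The relations: two ghost vectors are identified if they come from sequences with the same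
image in `A`. -/
def WRel (p : ℕ) (A : Type u) [Ring A] (n : ℕ) : AddSubgroup (Fin n → ModComm (FreeRing A)) :=
  AddSubgroup.closure {z | ∃ x y : ℕ → FreeRing A,
    (∀ i, i < n → freeProj A (x i) = freeProj A (y i)) ∧ z = ghostVec p n x - ghostVec p n y}

/-- The truncated group `W_n(A)`. -/
abbrev Wn (p : ℕ) (A : Type u) [Ring A] (n : ℕ) : Type u :=
  WFree p A n ⧸ (WRel p A n).addSubgroupOf (WFree p A n)

theorem ghost_map (p : ℕ) {R S : Type u} [Ring R] [Ring S] (f : R →+* S) (n : ℕ) (a : ℕ → R) :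
    f (ghost p n a) = ghost p n (fun i => f (a i)) := by
  simp [ghost]

/-- The map `(F_A / [F_A, F_A]) ^ n → (F_B / [F_B, F_B]) ^ n` induced by `f : A → B`. -/
def ghostTargetMap {A B : Type u} [Ring A] [Ring B] (f : A →+* B) (n : ℕ) :
    (Fin n → ModComm (FreeRing A)) →+ (Fin n → ModComm (FreeRing B)) :=
  (ModComm.map (FreeRing.map f)).compLeft (Fin n)

theorem ghostTargetMap_ghostVec (p : ℕ) {A B : Type u} [Ring A] [Ring B] (f : A →+* B) (n : ℕ)
    (a : ℕ → FreeRing A) :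
    ghostTargetMap f n (ghostVec p n a) = ghostVec p n (fun i => FreeRing.map f (a i)) := by
  funext i
  exact congrArg QuotientAddGroup.mk (ghost_map p (FreeRing.map f) i a)

theorem WFree_le_comap (p : ℕ) {A B : Type u} [Ring A] [Ring B] (f : A →+* B) (n : ℕ) :
    WFree p A n ≤ (WFree p B n).comap (ghostTargetMap f n) := by
  refine (AddSubgroup.closure_le _).2 ?_
  rintro _ ⟨a, rfl⟩
  exact AddSubgroup.subset_closure ⟨_, (ghostTargetMap_ghostVec p f n a).symm⟩

theorem WRel_le_comap (p : ℕ) {A B : Type u} [Ring A] [Ring B] (f : A →+* B) (n : ℕ) :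
    WRel p A n ≤ (WRel p B n).comap (ghostTargetMap f n) := by
  refine (AddSubgroup.closure_le _).2 ?_
  rintro _ ⟨x, y, h, rfl⟩
  refine AddSubgroup.subset_closure ⟨fun i => FreeRing.map f (x i),
    fun i => FreeRing.map f (y i), fun i hi => ?_, ?_⟩
  · rw [freeProj_map, freeProj_map, h i hi]
  · rw [map_sub, ghostTargetMap_ghostVec, ghostTargetMap_ghostVec]

/-- The map `W_n(F_A) → W_n(F_B)` induced by `f : A → B`. -/
def WFree.map (p : ℕ) {A B : Type u} [Ring A] [Ring B] (f : A →+* B) (n : ℕ) :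
    WFree p A n →+ WFree p B n :=
  ((ghostTargetMap f n).comp (WFree p A n).subtype).codRestrict (WFree p B n)
    fun x => WFree_le_comap p f n x.2

/-- The map `W_n(A) → W_n(B)` induced by `f : A → B`. -/
def Wn.map (p : ℕ) {A B : Type u} [Ring A] [Ring B] (f : A →+* B) (n : ℕ) :
    Wn p A n →+ Wn p B n :=
  QuotientAddGroup.map _ _ (WFree.map p f n) fun _ hx => WRel_le_comap p f n hx

/-- Forgetting the last ghost component. -/
def ghostRes (A : Type u) [Ring A] (n : ℕ) :
    (Fin (n + 1) → ModComm (FreeRing A)) →+ (Fin n → ModComm (FreeRing A)) where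
  toFun x i := x i.castSucc
  map_zero' := rfl
  map_add' _ _ := rfl

theorem WFree_le_comap_res (p : ℕ) (A : Type u) [Ring A] (n : ℕ) :
    WFree p A (n + 1) ≤ (WFree p A n).comap (ghostRes A n) := by
  refine (AddSubgroup.closure_le _).2 ?_
  rintro _ ⟨a, rfl⟩
  exact AddSubgroup.subset_closure ⟨a, rfl⟩

theorem WRel_le_comap_res (p : ℕ) (A : Type u) [Ring A] (n : ℕ) :
    WRel p A (n + 1) ≤ (WRel p A n).comap (ghostRes A n) := by
  refine (AddSubgroup.closure_le _).2 ?_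
  rintro _ ⟨x, y, h, rfl⟩
  exact AddSubgroup.subset_closure ⟨x, y, fun i hi => h i (by omega), rfl⟩

/-- The restriction `W_{n+1}(F) → W_n(F)` for the free ring `F` on `A`. -/
def WFree.res (p : ℕ) (A : Type u) [Ring A] (n : ℕ) : WFree p A (n + 1) →+ WFree p A n :=
  ((ghostRes A n).comp (WFree p A (n + 1)).subtype).codRestrict (WFree p A n)
    fun x => WFree_le_comap_res p A n x.2

/-- The restriction map `W_{n+1}(A) → W_n(A)`. -/
def Wn.res (p : ℕ) (A : Type u) [Ring A] (n : ℕ) : Wn p A (n + 1) →+ Wn p A n :=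
  QuotientAddGroup.map _ _ (WFree.res p A n) fun _ hx => WRel_le_comap_res p A n hx

theorem Wn.res_map (p : ℕ) {A B : Type u} [Ring A] [Ring B] (f : A →+* B) (n : ℕ)
    (x : Wn p A (n + 1)) : Wn.res p B n (Wn.map p f (n + 1) x) = Wn.map p f n (Wn.res p A n x) := by
  induction x using QuotientAddGroup.induction_on with
  | H x => rfl

/-- The inverse limit of the groups `W_n(A)`, as a subgroup of their product. -/
def WLim (p : ℕ) (A : Type u) [Ring A] : AddSubgroup (∀ n, Wn p A n) where
  carrier := {x | ∀ n, Wn.res p A n (x (n + 1)) = x n}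
  zero_mem' := fun n => map_zero (Wn.res p A n)
  add_mem' := fun {x y} hx hy n => by
    rw [Pi.add_apply, map_add, hx n, hy n, Pi.add_apply]
  neg_mem' := fun {x} hx n => by
    rw [Pi.neg_apply, map_neg, hx n, Pi.neg_apply]

/-- The group `W(A) = lim W_n(A)` of `p`-typical Witt vectors of the ring `A`. -/
def W (p : ℕ) (A : Type u) [Ring A] : Type u := WLim p A

instance (p : ℕ) (A : Type u) [Ring A] : AddCommGroup (W p A) :=
  inferInstanceAs (AddCommGroup (WLim p A))

/-- The inverse limit topology, the groups `W_n(A)` being discrete. -/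
instance (p : ℕ) (A : Type u) [Ring A] : TopologicalSpace (W p A) :=
  @instTopologicalSpaceSubtype _ (fun x => x ∈ WLim p A)
    (@Pi.topologicalSpace ℕ (fun n => Wn p A n) fun _ => ⊥)

/-- The homomorphism `W(A) → W(B)` induced by `f : A → B`. -/
def W.map (p : ℕ) {A B : Type u} [Ring A] [Ring B] (f : A →+* B) : W p A →+ W p B where
  toFun x := ⟨fun n => Wn.map p f n (x.1 n), fun n : ℕ => by
    change Wn.res p B n (Wn.map p f (n + 1) (x.1 (n + 1))) = Wn.map p f n (x.1 n)
    rw [Wn.res_map, x.2 n]⟩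
  map_zero' := Subtype.ext (funext fun n => map_zero (Wn.map p f n))
  map_add' x y := Subtype.ext (funext fun n => map_add (Wn.map p f n) (x.1 n) (y.1 n))

/-- The map of sets `q : A ^ ℕ → W(A)`, `(a₀, a₁, …) ↦ (a₀, a₁, …)`, computed by lifting the
coordinates to the free ring.  For commutative `A` it is the usual bijection between sequences and
Witt vectors. -/
def W.mk (p : ℕ) {A : Type u} [Ring A] (a : ℕ → A) : W p A :=
  ⟨fun n => QuotientAddGroup.mk ⟨ghostVec p n (fun i => FreeRing.of (a i)),
    AddSubgroup.subset_closure ⟨_, rfl⟩⟩, fun _ : ℕ => rfl⟩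

/-! ### The ring `E(A)` -/

/-- The ring `R ^ ℕ` with the product topology, `R` being discrete. -/
def Seq (R : Type u) : Type u := ℕ → R

instance (R : Type u) [Ring R] : Ring (Seq R) := inferInstanceAs (Ring (ℕ → R))

instance (R : Type u) : TopologicalSpace (Seq R) :=
  @Pi.topologicalSpace ℕ (fun _ => R) fun _ => ⊥

instance (R : Type u) [Ring R] : IsTopologicalRing (Seq R) := by
  let _ : TopologicalSpace R := ⊥
  have : DiscreteTopology R := ⟨rfl⟩
  exact inferInstanceAs (IsTopologicalRing (ℕ → R))

/-- The operator `V (a₀, a₁, …) = p (0, a₀, a₁, …)`. -/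
def Seq.V (p : ℕ) {R : Type u} [Ring R] : Seq R →+ Seq R where
  toFun a n := match n with
    | 0 => 0
    | n + 1 => (p : R) * a n
  map_zero' := by
    funext n
    cases n with
    | zero => rfl
    | succ n => exact mul_zero _
  map_add' a b := by
    funext n
    cases n with
    | zero => exact (add_zero (0 : R)).symm
    | succ n => exact mul_add _ _ _

/-- `⟨a⟩ = (a, a ^ p, a ^ (p ^ 2), …)`. -/
def Seq.teich (p : ℕ) {R : Type u} [Ring R] (a : R) : Seq R := fun n => a ^ p ^ n

/-- The elements `V ^ m (⟨a₁⟩ ⋯ ⟨aᵣ⟩)` with `m ≥ 0`, `r ≥ 1`, all `aᵢ` in `R` and at least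
one `aᵢ` in `S`.  For `S = R` there is no further condition on the `aᵢ`. -/
def Seq.gens (p : ℕ) {R : Type u} [Ring R] (S : Set R) : Set (Seq R) :=
  {x | ∃ (m : ℕ) (l : List R), (∃ a ∈ l, a ∈ S) ∧
    x = (Seq.V p)^[m] (l.map (Seq.teich p)).prod}

/-- The closed additive subgroup of `R ^ ℕ` generated by `Seq.gens p S`. -/
def Seq.closedSpan (p : ℕ) {R : Type u} [Ring R] (S : Set R) : AddSubgroup (Seq R) :=
  (AddSubgroup.closure (Seq.gens p S)).topologicalClosure

theorem Seq.iterate_V_apply (p : ℕ) {R : Type u} [Ring R] (m : ℕ) (a : Seq R) (n : ℕ) :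
    (Seq.V p)^[m] a n = if m ≤ n then (p : R) ^ m * a (n - m) else 0 := by
  induction m generalizing n with
  | zero => simp
  | succ m ih =>
    rw [Function.iterate_succ_apply']
    cases n with
    | zero => rw [if_neg (by omega)]; rfl
    | succ n =>
      change (p : R) * (Seq.V p)^[m] a n = _
      rw [ih]
      by_cases h : m ≤ n
      · simp [h, pow_succ', mul_assoc]
      · simp [h]

theorem Seq.continuous_V (p : ℕ) {R : Type u} [Ring R] :
    Continuous (Seq.V p : Seq R →+ Seq R) := by
  let _ : TopologicalSpace R := ⊥
  have : DiscreteTopology R := ⟨rfl⟩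
  refine continuous_pi (X := Seq R) (A := fun _ : ℕ => R) fun n => ?_
  cases n with
  | zero => exact continuous_const
  | succ n =>
    exact (continuous_of_discreteTopology (f := fun r : R => (p : R) * r)).comp
      (continuous_apply (A := fun _ : ℕ => R) n)

theorem Seq.prod_teich_apply (p : ℕ) {R : Type u} [Ring R] (l : List R) (n : ℕ) :
    (l.map (Seq.teich p)).prod n = (l.map fun a => a ^ p ^ n).prod := by
  induction l with
  | nil => rfl
  | cons a l ih =>
    rw [List.map_cons, List.prod_cons, List.map_cons, List.prod_cons, ← ih]
    rfl

theorem Seq.prod_teich_shift (p : ℕ) {R : Type u} [Ring R] (l : List R) (k n : ℕ) :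
    ((l.map fun a => a ^ p ^ k).map (Seq.teich p)).prod n =
      (l.map (Seq.teich p)).prod (n + k) := by
  rw [Seq.prod_teich_apply, Seq.prod_teich_apply, List.map_map]
  congr 2
  funext a
  simp [← pow_mul, ← pow_add, add_comm]

/-- The product rule `V ^ (m + k) x * V ^ m y = p ^ m V ^ (m + k) (x * F ^ k y)`, with `F` the
shift to the left. -/
theorem Seq.mul_left_rule (p : ℕ) {R : Type u} [Ring R] (m k : ℕ) (x y z : Seq R)
    (h : ∀ n, z n = y (n + k)) :
    (Seq.V p)^[m + k] x * (Seq.V p)^[m] y = (p ^ m) • (Seq.V p)^[m + k] (x * z) := by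
  funext n
  change (Seq.V p)^[m + k] x n * (Seq.V p)^[m] y n = (p ^ m) • ((Seq.V p)^[m + k] (x * z) n)
  rw [Seq.iterate_V_apply, Seq.iterate_V_apply, Seq.iterate_V_apply]
  by_cases h1 : m + k ≤ n
  · have h2 : m ≤ n := by omega
    have h3 : n - m = n - (m + k) + k := by omega
    rw [if_pos h1, if_pos h2, if_pos h1, h3, ← h, nsmul_eq_mul]
    change (p : R) ^ (m + k) * x _ * ((p : R) ^ m * z _) =
      ((p ^ m : ℕ) : R) * ((p : R) ^ (m + k) * (x _ * z _))
    have hc : Commute ((p : R) ^ m) ((p : R) ^ (m + k) * x (n - (m + k))) := by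
      rw [← Nat.cast_pow]
      exact Nat.cast_commute _ _
    rw [← mul_assoc, ← hc.eq, Nat.cast_pow]
    simp only [mul_assoc]
  · simp [h1]

theorem Seq.mul_right_rule (p : ℕ) {R : Type u} [Ring R] (m k : ℕ) (x y z : Seq R)
    (h : ∀ n, z n = y (n + k)) :
    (Seq.V p)^[m] y * (Seq.V p)^[m + k] x = (p ^ m) • (Seq.V p)^[m + k] (z * x) := by
  funext n
  change (Seq.V p)^[m] y n * (Seq.V p)^[m + k] x n = (p ^ m) • ((Seq.V p)^[m + k] (z * x) n)
  rw [Seq.iterate_V_apply, Seq.iterate_V_apply, Seq.iterate_V_apply]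
  by_cases h1 : m + k ≤ n
  · have h2 : m ≤ n := by omega
    have h3 : n - m = n - (m + k) + k := by omega
    rw [if_pos h1, if_pos h2, if_pos h1, h3, ← h, nsmul_eq_mul]
    change (p : R) ^ m * z _ * ((p : R) ^ (m + k) * x _) =
      ((p ^ m : ℕ) : R) * ((p : R) ^ (m + k) * (z _ * x _))
    have hc : Commute ((p : R) ^ (m + k)) (z (n - (m + k))) := by
      rw [← Nat.cast_pow]
      exact Nat.cast_commute _ _
    rw [Nat.cast_pow, mul_assoc, ← mul_assoc (z _), ← hc.eq]
    simp only [mul_assoc]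
  · simp [h1]

/-- A product of a generator for `S` with an arbitrary generator, in either order, is a multiple
of a generator for `S`. -/
theorem Seq.gens_mul (p : ℕ) {R : Type u} [Ring R] {S : Set R}
    (hS : ∀ a ∈ S, ∀ k : ℕ, a ^ p ^ k ∈ S) {x y : Seq R} (hx : x ∈ Seq.gens p S)
    (hy : y ∈ Seq.gens p (Set.univ : Set R)) :
    x * y ∈ AddSubgroup.closure (Seq.gens p S) ∧ y * x ∈ AddSubgroup.closure (Seq.gens p S) := by
  obtain ⟨m, l, ⟨a, hal, haS⟩, rfl⟩ := hx
  obtain ⟨m', l', -, rfl⟩ := hy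
  rcases le_total m' m with h | h
  · obtain ⟨k, rfl⟩ := Nat.exists_eq_add_of_le h
    constructor
    · rw [Seq.mul_left_rule p m' k _ _ _ (Seq.prod_teich_shift p l' k), ← List.prod_append,
        ← List.map_append]
      refine nsmul_mem (AddSubgroup.subset_closure ?_) _
      exact ⟨_, _, ⟨a, List.mem_append_left _ hal, haS⟩, rfl⟩
    · rw [Seq.mul_right_rule p m' k _ _ _ (Seq.prod_teich_shift p l' k), ← List.prod_append,
        ← List.map_append]
      refine nsmul_mem (AddSubgroup.subset_closure ?_) _
      exact ⟨_, _, ⟨a, List.mem_append_right _ hal, haS⟩, rfl⟩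
  · obtain ⟨k, rfl⟩ := Nat.exists_eq_add_of_le h
    have ha : a ^ p ^ k ∈ l.map fun b => b ^ p ^ k := List.mem_map.2 ⟨a, hal, rfl⟩
    constructor
    · rw [Seq.mul_right_rule p m k _ _ _ (Seq.prod_teich_shift p l k), ← List.prod_append,
        ← List.map_append]
      refine nsmul_mem (AddSubgroup.subset_closure ?_) _
      exact ⟨_, _, ⟨_, List.mem_append_left _ ha, hS a haS k⟩, rfl⟩
    · rw [Seq.mul_left_rule p m k _ _ _ (Seq.prod_teich_shift p l k), ← List.prod_append,
        ← List.map_append]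
      refine nsmul_mem (AddSubgroup.subset_closure ?_) _
      exact ⟨_, _, ⟨_, List.mem_append_right _ ha, hS a haS k⟩, rfl⟩

theorem Seq.closedSpan_mul (p : ℕ) {R : Type u} [Ring R] {S : Set R}
    (hS : ∀ a ∈ S, ∀ k : ℕ, a ^ p ^ k ∈ S) {x y : Seq R} (hx : x ∈ Seq.closedSpan p S)
    (hy : y ∈ Seq.closedSpan p (Set.univ : Set R)) :
    x * y ∈ Seq.closedSpan p S ∧ y * x ∈ Seq.closedSpan p S := by
  have key : ∀ x ∈ AddSubgroup.closure (Seq.gens p S),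
      ∀ y ∈ AddSubgroup.closure (Seq.gens p (Set.univ : Set R)),
      x * y ∈ AddSubgroup.closure (Seq.gens p S) ∧
        y * x ∈ AddSubgroup.closure (Seq.gens p S) := by
    intro x hx y hy
    induction hx using AddSubgroup.closure_induction with
    | zero => simp
    | neg x _ ih => simpa using ih
    | add x x' _ _ h h' =>
      rw [add_mul, mul_add]
      exact ⟨add_mem h.1 h'.1, add_mem h.2 h'.2⟩
    | mem x hx =>
      induction hy using AddSubgroup.closure_induction with
      | zero => simp
      | neg y _ ih => simpa using ih
      | add y y' _ _ h h' =>
        rw [add_mul, mul_add]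
        exact ⟨add_mem h.1 h'.1, add_mem h.2 h'.2⟩
      | mem y hy => exact Seq.gens_mul p hS hx hy
  constructor
  · exact map_mem_closure₂ (f := fun a b : Seq R => a * b) continuous_mul hx hy
      fun a ha b hb => (key a ha b hb).1
  · exact map_mem_closure₂ (f := fun a b : Seq R => b * a) (continuous_snd.mul continuous_fst)
      hx hy fun a ha b hb => (key a ha b hb).2

theorem Seq.V_mem_closedSpan (p : ℕ) {R : Type u} [Ring R] {S : Set R} {x : Seq R}
    (hx : x ∈ Seq.closedSpan p S) : Seq.V p x ∈ Seq.closedSpan p S := by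
  refine map_mem_closure (Seq.continuous_V p) hx fun y hy => ?_
  have h : AddSubgroup.closure (Seq.gens p S) ≤
      (AddSubgroup.closure (Seq.gens p S)).comap (Seq.V p) := by
    refine (AddSubgroup.closure_le _).2 ?_
    rintro _ ⟨m, l, hl, rfl⟩
    exact AddSubgroup.subset_closure ⟨m + 1, l, hl, (Function.iterate_succ_apply' _ _ _).symm⟩
  exact h hy

theorem Seq.closedSpan_mono (p : ℕ) {R : Type u} [Ring R] {S T : Set R} (h : S ⊆ T) :
    Seq.closedSpan p S ≤ Seq.closedSpan p T := by
  refine closure_mono (SetLike.coe_subset_coe.2 (AddSubgroup.closure_mono ?_))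
  rintro _ ⟨m, l, ⟨a, hl, ha⟩, rfl⟩
  exact ⟨m, l, ⟨a, hl, h ha⟩, rfl⟩

/-- The closed subring `X(R)` of `R ^ ℕ`: the closed subgroup generated by all
`V ^ m (⟨a₁⟩ ⋯ ⟨aᵣ⟩)`. -/
def X (p : ℕ) (R : Type u) [Ring R] : Subring (Seq R) where
  carrier := Seq.closedSpan p (Set.univ : Set R)
  zero_mem' := zero_mem _
  add_mem' := add_mem
  neg_mem' := neg_mem
  one_mem' := by
    refine subset_closure (AddSubgroup.subset_closure ⟨0, [1], ⟨1, by simp, trivial⟩, ?_⟩)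
    funext n
    simp [Seq.teich]
    rfl
  mul_mem' := fun hx hy =>
    (Seq.closedSpan_mul p (S := Set.univ) (fun _ _ _ => Set.mem_univ _) hx hy).1

/-- The operator `V` on `X(R)`. -/
def X.V (p : ℕ) (R : Type u) [Ring R] : X p R →+ X p R :=
  ((Seq.V p).comp (X p R).toAddSubgroup.subtype).codRestrict (X p R).toAddSubgroup
    fun x => Seq.V_mem_closedSpan p x.2

/-- The element `⟨a⟩` of `X(R)`. -/
def X.teich (p : ℕ) {R : Type u} [Ring R] (a : R) : X p R :=
  ⟨Seq.teich p a, subset_closure (AddSubgroup.subset_closure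
    ⟨0, [a], ⟨a, by simp, trivial⟩, by simp⟩)⟩

theorem pow_mem_ideal (p : ℕ) [hp : Fact p.Prime] {R : Type u} [Ring R] (I : Ideal R) :
    ∀ a ∈ (I : Set R), ∀ k : ℕ, a ^ p ^ k ∈ (I : Set R) := fun _ ha k =>
  I.pow_mem_of_mem ha _ (pow_pos hp.out.pos k)

/-- The closed two-sided ideal `X(I)` of `X(R)` attached to a two-sided ideal `I` of `R`: the closed
subgroup generated by all `V ^ m (⟨a₁⟩ ⋯ ⟨aᵣ⟩)` with at least one factor `aᵢ` in `I`.
This is the smallest closed two-sided ideal of `X(R)` which is stable under `V` and contains `⟨a⟩`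
for all `a ∈ I`.  (If `R` is commutative, then `⟨a₁⟩ ⋯ ⟨aᵣ⟩ = ⟨a₁ ⋯ aᵣ⟩`, and asking for all
factors to lie in `I` gives the same subgroup; for noncommutative `R` that subgroup is smaller and
need not be an ideal.) -/
def XIdeal (p : ℕ) [Fact p.Prime] {R : Type u} [Ring R] (I : Ideal R) : Ideal (X p R) where
  carrier := {x | (x : Seq R) ∈ Seq.closedSpan p (I : Set R)}
  zero_mem' := zero_mem (Seq.closedSpan p (I : Set R))
  add_mem' := fun {_ _} hx hy => (Seq.closedSpan p (I : Set R)).add_mem hx hy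
  smul_mem' := fun c _ hx => (Seq.closedSpan_mul p (pow_mem_ideal p I) hx c.2).2

instance (p : ℕ) [Fact p.Prime] {R : Type u} [Ring R] (I : Ideal R) : (XIdeal p I).IsTwoSided where
  mul_mem_of_left {a} c hx := (Seq.closedSpan_mul p (pow_mem_ideal p I)
    (show (a : Seq R) ∈ Seq.closedSpan p (I : Set R) from hx) c.2).1

/-- The canonical surjection `ℤA → A` from the monoid algebra of the multiplicative monoid of `A`,
with `[a] ↦ a`. -/
def augmentation (A : Type u) [Ring A] : MonoidAlgebra ℤ A →+* A :=
  (MonoidAlgebra.lift ℤ A A (MonoidHom.id A)).toRingHom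

/-- The kernel of `ℤA → A`. -/
def augKer (A : Type u) [Ring A] : Ideal (MonoidAlgebra ℤ A) := RingHom.ker (augmentation A)

/-- The ring `E(A) = X(ℤA) / X(I)`, where `I` is the kernel of `ℤA → A`. -/
def E (p : ℕ) [Fact p.Prime] (A : Type u) [Ring A] : Type u :=
  X p (MonoidAlgebra ℤ A) ⧸ XIdeal p (augKer A)

section E

variable (p : ℕ) [Fact p.Prime] (A : Type u) [Ring A]

instance : Ring (E p A) :=
  inferInstanceAs (Ring (X p (MonoidAlgebra ℤ A) ⧸ XIdeal p (augKer A)))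

/-- The quotient map `X(ℤA) → E(A)`. -/
def E.mk : X p (MonoidAlgebra ℤ A) →+* E p A := Ideal.Quotient.mk (XIdeal p (augKer A))

theorem E.mk_surjective : Function.Surjective (E.mk p A) := Ideal.Quotient.mk_surjective

/-- The quotient topology. -/
instance : TopologicalSpace (E p A) := TopologicalSpace.coinduced (E.mk p A) inferInstance

instance : IsTopologicalAddGroup (E p A) :=
  QuotientAddGroup.instIsTopologicalAddGroup (XIdeal p (augKer A)).toAddSubgroup

/-- The operator `V` on `E(A)`, induced by `V` on `X(ℤA)`. -/
def E.V : E p A →+ E p A :=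
  QuotientAddGroup.map (XIdeal p (augKer A)).toAddSubgroup (XIdeal p (augKer A)).toAddSubgroup
    (X.V p (MonoidAlgebra ℤ A)) fun x (hx : (x : Seq (MonoidAlgebra ℤ A)) ∈
      Seq.closedSpan p (augKer A : Set (MonoidAlgebra ℤ A))) =>
    show Seq.V p (x : Seq (MonoidAlgebra ℤ A)) ∈
      Seq.closedSpan p (augKer A : Set (MonoidAlgebra ℤ A)) from Seq.V_mem_closedSpan p hx

theorem E.V_mk (x : X p (MonoidAlgebra ℤ A)) : E.V p A (E.mk p A x) = E.mk p A (X.V p _ x) := rfl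

variable {A} in
/-- The element `⟨a⟩` of `E(A)`, the class of `([a], [a] ^ p, [a] ^ (p ^ 2), …)`. -/
def E.teich (a : A) : E p A := E.mk p A (X.teich p (MonoidAlgebra.of ℤ A a))

/-- The group `HH₀(E(A))`, the quotient of `E(A)` by the closure of `[E(A), E(A)]`, with the
quotient topology. -/
abbrev HH0E : Type u := E p A ⧸ (commutators (E p A)).topologicalClosure

end E

/-- The map `R ^ ℕ → S ^ ℕ` induced by `f : R → S`. -/
def Seq.map {R S : Type u} [Ring R] [Ring S] (f : R →+* S) : Seq R →+* Seq S where
  toFun a n := f (a n)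
  map_zero' := funext fun _ => map_zero f
  map_one' := funext fun _ => map_one f
  map_add' _ _ := funext fun _ => map_add f _ _
  map_mul' _ _ := funext fun _ => map_mul f _ _

theorem Seq.continuous_map {R S : Type u} [Ring R] [Ring S] (f : R →+* S) :
    Continuous (Seq.map f) := by
  let _ : TopologicalSpace R := ⊥
  have : DiscreteTopology R := ⟨rfl⟩
  let _ : TopologicalSpace S := ⊥
  exact continuous_pi (X := Seq R) (A := fun _ : ℕ => S) fun n =>
    (continuous_of_discreteTopology (f := f)).comp (continuous_apply (A := fun _ : ℕ => R) n)

theorem Seq.map_gens (p : ℕ) {R S : Type u} [Ring R] [Ring S] (f : R →+* S) {I : Set R}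
    {J : Set S} (h : ∀ a ∈ I, f a ∈ J) {x : Seq R} (hx : x ∈ Seq.gens p I) :
    Seq.map f x ∈ Seq.gens p J := by
  obtain ⟨m, l, ⟨a, hl, ha⟩, rfl⟩ := hx
  refine ⟨m, l.map f, ⟨f a, List.mem_map.2 ⟨a, hl, rfl⟩, h a ha⟩, ?_⟩
  funext n
  change f ((Seq.V p)^[m] _ n) = _
  rw [Seq.iterate_V_apply, Seq.iterate_V_apply]
  split_ifs
  · rw [Seq.prod_teich_apply, Seq.prod_teich_apply, map_mul, map_pow, map_natCast, map_list_prod,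
      List.map_map, List.map_map]
    congr 3
    funext b
    simp
  · exact map_zero f

theorem Seq.map_mem_closedSpan (p : ℕ) {R S : Type u} [Ring R] [Ring S] (f : R →+* S) {I : Set R}
    {J : Set S} (h : ∀ a ∈ I, f a ∈ J) {x : Seq R} (hx : x ∈ Seq.closedSpan p I) :
    Seq.map f x ∈ Seq.closedSpan p J := by
  refine map_mem_closure (Seq.continuous_map f) hx fun y hy => ?_
  have h' : AddSubgroup.closure (Seq.gens p I) ≤
      (AddSubgroup.closure (Seq.gens p J)).comap (Seq.map f).toAddMonoidHom :=
    (AddSubgroup.closure_le _).2 fun z hz => AddSubgroup.subset_closure (Seq.map_gens p f h hz)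
  exact h' hy

/-- The ring homomorphism `X(R) → X(S)` induced by `f : R → S`. -/
def X.map (p : ℕ) {R S : Type u} [Ring R] [Ring S] (f : R →+* S) : X p R →+* X p S :=
  (Seq.map f).restrict (X p R) (X p S) fun _ hx =>
    Seq.map_mem_closedSpan p f (I := Set.univ) (J := Set.univ) (fun _ _ => Set.mem_univ _) hx

theorem X.continuous_map (p : ℕ) {R S : Type u} [Ring R] [Ring S] (f : R →+* S) :
    Continuous (X.map p f) :=
  ((Seq.continuous_map f).comp continuous_subtype_val).subtype_mk _

/-- The map `ℤA → ℤB` induced by `f : A → B`. -/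
def algMap {A B : Type u} [Ring A] [Ring B] (f : A →+* B) :
    MonoidAlgebra ℤ A →+* MonoidAlgebra ℤ B :=
  MonoidAlgebra.mapDomainRingHom ℤ (f : A →* B)

theorem augmentation_of (A : Type u) [Ring A] (a : A) :
    augmentation A (MonoidAlgebra.of ℤ A a) = a :=
  MonoidAlgebra.lift_of (MonoidHom.id A) a

theorem algMap_of {A B : Type u} [Ring A] [Ring B] (f : A →+* B) (a : A) :
    algMap f (MonoidAlgebra.of ℤ A a) = MonoidAlgebra.of ℤ B (f a) :=
  MonoidAlgebra.mapDomain_single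

theorem augmentation_algMap {A B : Type u} [Ring A] [Ring B] (f : A →+* B)
    (x : MonoidAlgebra ℤ A) : augmentation B (algMap f x) = f (augmentation A x) := by
  have h : (augmentation B).comp (algMap f) = f.comp (augmentation A) := by
    refine MonoidAlgebra.ringHom_ext' (RingHom.ext_int _ _) (MonoidHom.ext fun a => ?_)
    change augmentation B (algMap f (MonoidAlgebra.of ℤ A a)) =
      f (augmentation A (MonoidAlgebra.of ℤ A a))
    rw [algMap_of, augmentation_of, augmentation_of]
  exact congrArg (fun g : MonoidAlgebra ℤ A →+* B => g x) h

theorem algMap_mem_augKer {A B : Type u} [Ring A] [Ring B] (f : A →+* B) {x : MonoidAlgebra ℤ A}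
    (hx : x ∈ augKer A) : algMap f x ∈ augKer B := by
  have h : augmentation A x = 0 := hx
  change augmentation B (algMap f x) = 0
  rw [augmentation_algMap, h, map_zero]

section functoriality

variable (p : ℕ) [Fact p.Prime] {A B : Type u} [Ring A] [Ring B] (f : A →+* B)

/-- The ring homomorphism `E(A) → E(B)` induced by `f : A → B`. -/
def E.map : E p A →+* E p B :=
  Ideal.Quotient.lift (XIdeal p (augKer A)) ((E.mk p B).comp (X.map p (algMap f))) fun x hx =>
    Ideal.Quotient.eq_zero_iff_mem.2 <|
      show Seq.map (algMap f) (x : Seq (MonoidAlgebra ℤ A)) ∈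
          Seq.closedSpan p (augKer B : Set (MonoidAlgebra ℤ B)) from
        Seq.map_mem_closedSpan p (algMap f) (fun _ ha => algMap_mem_augKer f ha) hx

theorem E.continuous_map : Continuous (E.map p f) :=
  continuous_coinduced_dom.2 (continuous_coinduced_rng.comp (X.continuous_map p (algMap f)))

/-- The homomorphism `HH₀(E(A)) → HH₀(E(B))` induced by `f : A → B`. -/
def HH0E.map : HH0E p A →+ HH0E p B :=
  QuotientAddGroup.map _ _ (E.map p f).toAddMonoidHom fun _ hx =>
    map_mem_closure (E.continuous_map p f) hx fun _ hy => commutators_le_comap (E.map p f) hy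

end functoriality

end NCWitt

end

namespace NCWitt

/-! ### Ghost components of `E(A)` -/

/-! The values of such a transformation are too few to be surjective. A vector with a single nonzero
entry `a` comes from the commutative ring ℤ[X] via X ↦ a. So naturality and the formula on
commutative rings force its image to lie in the closure of the group generated by the V^n⟨b⟩. These
vectors generate a dense subgroup of W(A) (`W.dense_closure_single`), because the ghost polynomials
contain no mixed monomials. Hence every continuous functional ψ on HH₀(E(A)), with values in a
Hausdorff group, that kills all V^n⟨b⟩ kills the whole image of φ_A (`comp_eq_zero_of_natural`).

For A = M₂(𝔽_p) there is such a ψ that is nonzero. The map ℤA → A induces ghost components E(A) →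
A^ℕ (`E.toSeq`), and ψ(s) = tr(s₁) - tr(s₀) vanishes on commutators. It kills ⟨a⟩ because tr(a^p) =
tr(a) over 𝔽_p, and V^n⟨a⟩ with n ≥ 1 because p = 0 (`HH0E.traceDiff_V_teich`). On a product,
however, ψ(⟨x⟩⟨y⟩) = tr(x^p y^p) - tr(xy), which is -1 for the matrix units x = e₁₂, y = e₂₁. Thus
⟨x⟩⟨y⟩ is not in the image. -/

theorem Seq.t2Space (R : Type u) : T2Space (Seq R) := by
  let _ : TopologicalSpace R := ⊥
  have : DiscreteTopology R := ⟨rfl⟩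
  exact inferInstanceAs (T2Space (ℕ → R))

/-- A generator has a factor ⟨0⟩, which is zero in every coordinate because p^n > 0, and {0} is
closed. This is what makes the ghost components well defined on the quotient by X(I). -/
theorem Seq.eq_zero_of_mem_closedSpan (p : ℕ) [hp : Fact p.Prime] {R : Type u} [Ring R] {x : Seq R}
    (hx : x ∈ Seq.closedSpan p ({0} : Set R)) : x = 0 := by
  have := Seq.t2Space R
  have h : AddSubgroup.closure (Seq.gens p ({0} : Set R)) ≤ ⊥ := by
    refine (AddSubgroup.closure_le _).2 ?_
    rintro _ ⟨m, l, ⟨a, hl, rfl : a = 0⟩, rfl⟩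
    have h0 : (l.map (Seq.teich p)).prod = 0 := by
      funext n
      rw [Seq.prod_teich_apply]
      exact List.prod_eq_zero (List.mem_map.2 ⟨0, hl, zero_pow (pow_pos hp.out.pos n).ne'⟩)
    rw [h0]
    exact iterate_map_zero (Seq.V p) m
  exact closure_minimal (s := (AddSubgroup.closure (Seq.gens p ({0} : Set R)) : Set (Seq R)))
    (t := {0}) h isClosed_singleton hx

section ghost

variable (p : ℕ) [Fact p.Prime] (A : Type u) [Ring A]

/-- The ring homomorphism `E(A) → A ^ ℕ` induced by `ℤA → A`. -/
noncomputable def E.toSeq : E p A →+* Seq A :=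
  Ideal.Quotient.lift (XIdeal p (augKer A)) ((Seq.map (augmentation A)).comp (X p _).subtype)
    -- ℤA → A sends I to 0, so it sends X(I) into the closed span attached to {0}, which is trivial.
    fun _ hx => Seq.eq_zero_of_mem_closedSpan p <|
      Seq.map_mem_closedSpan p (augmentation A) (I := (augKer A : Set (MonoidAlgebra ℤ A)))
        (J := {0}) (fun _ ha => ha) hx

theorem E.toSeq_mk (x : X p (MonoidAlgebra ℤ A)) :
    E.toSeq p A (E.mk p A x) = Seq.map (augmentation A) x := rfl

theorem E.continuous_toSeq : Continuous (E.toSeq p A) :=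
  continuous_coinduced_dom.2 ((Seq.continuous_map (augmentation A)).comp continuous_subtype_val)

variable {A}

theorem E.toSeq_teich (a : A) : E.toSeq p A (E.teich p a) = Seq.teich p a := by
  funext n
  change augmentation A ((MonoidAlgebra.of ℤ A a) ^ p ^ n) = a ^ p ^ n
  rw [map_pow, augmentation_of]

theorem E.toSeq_V (x : E p A) : E.toSeq p A (E.V p A x) = Seq.V p (E.toSeq p A x) := by
  obtain ⟨x, rfl⟩ := E.mk_surjective p A x
  rw [E.V_mk, E.toSeq_mk, E.toSeq_mk]
  funext n
  cases n with
  | zero => exact map_zero (augmentation A)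
  | succ n =>
    refine (map_mul (augmentation A) _ _).trans ?_
    rw [map_natCast]
    rfl

theorem E.toSeq_iterate_V (n : ℕ) (x : E p A) :
    E.toSeq p A ((E.V p A)^[n] x) = (Seq.V p)^[n] (E.toSeq p A x) :=
  Function.Semiconj.iterate_right (f := E.toSeq p A) (E.toSeq_V p) n x

/-! ### Functoriality of ⟨a⟩ and V. -/

theorem E.map_mk {B : Type u} [Ring B] (f : A →+* B) (x : X p (MonoidAlgebra ℤ A)) :
    E.map p f (E.mk p A x) = E.mk p B (X.map p (algMap f) x) := rfl

theorem E.map_teich {B : Type u} [Ring B] (f : A →+* B) (a : A) :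
    E.map p f (E.teich p a) = E.teich p (f a) := by
  refine congrArg (E.mk p B) (Subtype.ext (funext fun n => ?_))
  change algMap f (MonoidAlgebra.of ℤ A a ^ p ^ n) = MonoidAlgebra.of ℤ B (f a) ^ p ^ n
  rw [map_pow, algMap_of]

theorem E.map_V {B : Type u} [Ring B] (f : A →+* B) (x : E p A) :
    E.map p f (E.V p A x) = E.V p B (E.map p f x) := by
  obtain ⟨x, rfl⟩ := E.mk_surjective p A x
  rw [E.V_mk, E.map_mk, E.map_mk, E.V_mk]
  refine congrArg (E.mk p B) (Subtype.ext (funext fun n => ?_))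
  cases n with
  | zero => exact map_zero (algMap f)
  | succ n =>
    refine (map_mul (algMap f) _ _).trans ?_
    rw [map_natCast]
    rfl

theorem E.map_iterate_V {B : Type u} [Ring B] (f : A →+* B) (n : ℕ) (x : E p A) :
    E.map p f ((E.V p A)^[n] x) = (E.V p B)^[n] (E.map p f x) :=
  Function.Semiconj.iterate_right (f := E.map p f) (E.map_V p f) n x

theorem HH0E.continuous_map {B : Type u} [Ring B] (f : A →+* B) : Continuous (HH0E.map p f) :=
  continuous_quot_lift _ (continuous_quot_mk.comp (E.continuous_map p f))

end ghost

/-! ### The functional attached to a trace -/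

section trace

variable (p : ℕ) [Fact p.Prime] {A : Type u} [Ring A] {M : Type*} [AddCommGroup M]

/-- The homomorphism `s ↦ τ (s 1) - τ (s 0)`. -/
def Seq.traceDiff (τ : A →+ M) : Seq A →+ M where
  toFun s := τ (s 1) - τ (s 0)
  map_zero' := by
    change τ 0 - τ 0 = 0
    exact sub_self _
  map_add' s t := by
    change τ (s 1 + t 1) - τ (s 0 + t 0) = _
    rw [map_add, map_add, add_sub_add_comm]

/-- Only two coordinates enter and A × A is discrete, so any topology on M will do. -/
theorem Seq.continuous_traceDiff [TopologicalSpace M] (τ : A →+ M) :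
    Continuous (Seq.traceDiff τ) := by
  let _ : TopologicalSpace A := ⊥
  have : DiscreteTopology A := ⟨rfl⟩
  exact (continuous_of_discreteTopology (f := fun z : A × A => τ z.1 - τ z.2)).comp
    ((continuous_apply (A := fun _ : ℕ => A) 1).prodMk (continuous_apply (A := fun _ : ℕ => A) 0))

/-- The ghost map is multiplicative for the coordinatewise product, so τ kills each coordinate of a
commutator. The zero set of the functional is closed because M is Hausdorff, so it also contains the
closure of the commutator subgroup. -/
theorem E.traceDiff_eq_zero [TopologicalSpace M] [T2Space M] {τ : A →+ M}
    (hτ : ∀ a b, τ (a * b) = τ (b * a)) {x : E p A}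
    (hx : x ∈ (commutators (E p A)).topologicalClosure) :
    Seq.traceDiff τ (E.toSeq p A x) = 0 := by
  have hc : IsClosed {x : E p A | Seq.traceDiff τ (E.toSeq p A x) = 0} :=
    isClosed_eq ((Seq.continuous_traceDiff τ).comp (E.continuous_toSeq p A)) continuous_const
  refine closure_minimal (fun y hy => ?_) hc hx
  have h : commutators (E p A) ≤
      ((Seq.traceDiff τ).comp (E.toSeq p A).toAddMonoidHom).ker := by
    refine (AddSubgroup.closure_le _).2 ?_
    rintro _ ⟨⟨a, b⟩, rfl⟩
    change Seq.traceDiff τ (E.toSeq p A (a * b - b * a)) = 0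
    rw [map_sub, map_sub, map_mul (E.toSeq p A), map_mul (E.toSeq p A), sub_eq_zero]
    exact congrArg₂ (· - ·) (hτ _ _) (hτ _ _)
  exact h hy

/-- The functional `x ↦ τ (x₁) - τ (x₀)` on `HH₀(E(A))` defined by a trace `τ` on `A`. -/
noncomputable def HH0E.traceDiff [TopologicalSpace M] [T2Space M] (τ : A →+ M)
    (hτ : ∀ a b, τ (a * b) = τ (b * a)) : HH0E p A →+ M :=
  QuotientAddGroup.lift _ ((Seq.traceDiff τ).comp (E.toSeq p A).toAddMonoidHom)
    fun _ hx => E.traceDiff_eq_zero p hτ hx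

variable [TopologicalSpace M] [T2Space M] (τ : A →+ M) (hτ : ∀ a b, τ (a * b) = τ (b * a))

theorem HH0E.continuous_traceDiff : Continuous (HH0E.traceDiff p τ hτ) :=
  continuous_quot_lift _ ((Seq.continuous_traceDiff τ).comp (E.continuous_toSeq p A))

theorem HH0E.traceDiff_mk (x : E p A) :
    HH0E.traceDiff p τ hτ (QuotientAddGroup.mk x) = Seq.traceDiff τ (E.toSeq p A x) := rfl

/-- If `p` kills the trace `τ` and `τ (a ^ p) = τ a`, then the functional kills all `V ^ n ⟨a⟩`. -/
theorem HH0E.traceDiff_V_teich (hp : ∀ a, τ (p * a) = 0) (hF : ∀ a, τ (a ^ p) = τ a) (n : ℕ)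
    (a : A) :
    HH0E.traceDiff p τ hτ (QuotientAddGroup.mk ((E.V p A)^[n] (E.teich p a))) = 0 := by
  rw [HH0E.traceDiff_mk, E.toSeq_iterate_V, E.toSeq_teich]
  -- For n = 0 the value is τ(a^p) - τ(a). For n > 0 coordinate 0 vanishes and coordinate 1 is a
  -- multiple of p.
  cases n with
  | zero =>
    change τ (a ^ p ^ 1) - τ (a ^ p ^ 0) = 0
    rw [pow_one, pow_zero, pow_one, hF, sub_self]
  | succ n =>
    rw [Function.iterate_succ_apply']
    change τ (p * _) - τ 0 = 0
    rw [hp, map_zero, sub_zero]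

end trace

/-! ### Generators of `W(A)` -/

section generators

variable (p : ℕ) {A : Type u} [Ring A]

theorem W.map_mk {B : Type u} [Ring B] (f : A →+* B) (a : ℕ → A) :
    W.map p f (W.mk p a) = W.mk p (fun i => f (a i)) := by
  refine Subtype.ext (funext fun n => congrArg QuotientAddGroup.mk (Subtype.ext ?_))
  refine (ghostTargetMap_ghostVec p f n _).trans ?_
  simp only [FreeRing.map_of]

/-- Each summand of the ghost polynomial involves one variable only, and a zero entry contributes
nothing since its exponent is positive. So the identity holds in A itself, before commutators are
divided out. -/
theorem ghost_eq_sum_single [hp : Fact p.Prime] (n : ℕ) (a : ℕ → A) {k : ℕ} (hk : n < k) :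
    ghost p n a = ∑ i ∈ Finset.range k, ghost p n (Pi.single i (a i)) := by
  have h : ∀ i j, (p : A) ^ j * (Pi.single i (a i) : ℕ → A) j ^ p ^ (n - j) =
      if j = i then (p : A) ^ j * a j ^ p ^ (n - j) else 0 := by
    intro i j
    split_ifs with hij
    · subst hij
      rw [Pi.single_eq_same]
    · rw [Pi.single_eq_of_ne hij, zero_pow (pow_pos hp.out.pos _).ne', mul_zero]
  simp only [ghost, h]
  rw [Finset.sum_comm]
  refine Finset.sum_congr rfl fun j hj => ?_
  rw [Finset.sum_ite_eq, if_pos]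
  simp only [Finset.mem_range] at hj ⊢
  omega

theorem ghostVec_eq_sum_single [Fact p.Prime] (n : ℕ) (a : ℕ → A) :
    ghostVec p n a = ∑ i ∈ Finset.range n, ghostVec p n (Pi.single i (a i)) := by
  funext j
  rw [Finset.sum_apply]
  change QuotientAddGroup.mk' _ (ghost p j a) = ∑ i ∈ _, QuotientAddGroup.mk' _ (ghost p j _)
  rw [← map_sum, ← ghost_eq_sum_single p j a j.2]

/-- The defining relations allow any lift to be replaced by the standard lift `FreeRing.of` of its
image. -/
theorem Wn.mk_ghostVec_eq (n : ℕ) (x : ℕ → FreeRing A) (hx : ghostVec p n x ∈ WFree p A n) :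
    (QuotientAddGroup.mk ⟨ghostVec p n x, hx⟩ : Wn p A n) =
      (W.mk p fun i => freeProj A (x i)).1 n := by
  refine (QuotientAddGroup.eq_iff_sub_mem).2 ?_
  exact AddSubgroup.subset_closure ⟨x, _, fun i _ => by simp [freeProj], rfl⟩

/-- Every element of `W_n(A)` is the image of an element of the subgroup of `W(A)` generated by
the vectors with at most one nonzero entry. -/
theorem Wn.exists_mem_closure_single [Fact p.Prime] (n : ℕ) (z : Wn p A n) :
    ∃ w ∈ AddSubgroup.closure
      (Set.range fun t : ℕ × A => (W.mk p (Pi.single t.1 t.2) : W p A)), w.1 n = z := by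
  set S := AddSubgroup.closure (Set.range fun t : ℕ × A => (W.mk p (Pi.single t.1 t.2) : W p A))
  let ev : W p A →+ Wn p A n := (Pi.evalAddMonoidHom _ n).comp (WLim p A).subtype
  -- The image of `S` is a subgroup, so it suffices to treat a single ghost vector, which splits
  -- into those of its single-entry parts.
  have key : ∀ y (hy : y ∈ WFree p A n), (QuotientAddGroup.mk ⟨y, hy⟩ : Wn p A n) ∈ S.map ev := by
    intro y hy
    induction hy using AddSubgroup.closure_induction with
    | zero => exact zero_mem (S.map ev)
    | add y y' _ _ h h' => exact add_mem h h'
    | neg y _ h => exact neg_mem h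
    | mem y hy =>
      obtain ⟨x, rfl⟩ := hy
      have hmem : ∀ x, ghostVec p n x ∈ WFree p A n := fun x =>
        AddSubgroup.subset_closure ⟨x, rfl⟩
      have hsum : (⟨ghostVec p n x, hmem x⟩ : WFree p A n) =
          ∑ i ∈ Finset.range n, ⟨ghostVec p n (Pi.single i (x i)), hmem _⟩ := by
        refine Subtype.ext ?_
        rw [AddSubgroup.val_finsetSum]
        exact ghostVec_eq_sum_single p n x
      change QuotientAddGroup.mk' _ (⟨ghostVec p n x, hmem x⟩ : WFree p A n) ∈ S.map ev
      rw [hsum, map_sum]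
      refine sum_mem fun i _ => ⟨W.mk p (Pi.single i (freeProj A (x i))),
        AddSubgroup.subset_closure ⟨(i, _), rfl⟩, ?_⟩
      refine Eq.trans ?_ (Wn.mk_ghostVec_eq p n (Pi.single i (x i)) (hmem _)).symm
      change (W.mk p _).1 n = _
      exact congrArg (fun b : ℕ → A => (W.mk p b).1 n) <| funext fun j =>
        (Pi.apply_single (fun _ => freeProj A) (fun _ => map_zero _) i (x i) j).symm
  induction z using QuotientAddGroup.induction_on with
  | H z => exact key z.1 z.2

/-- The n-th component determines all lower ones by restriction, so the finitely many conditions of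
a basic open set reduce to one component. -/
theorem W.eq_of_le {w w' : W p A} {n : ℕ} (h : w.1 n = w'.1 n) {m : ℕ} (hm : m ≤ n) :
    w.1 m = w'.1 m := by
  induction n, hm using Nat.le_induction with
  | base => exact h
  | succ n _ ih => exact ih (by rw [← w.2 n, ← w'.2 n, h])

/-- The vectors with at most one nonzero entry generate a dense subgroup of `W(A)`. -/
theorem W.dense_closure_single [Fact p.Prime] :
    Dense (AddSubgroup.closure
      (Set.range fun t : ℕ × A => (W.mk p (Pi.single t.1 t.2) : W p A)) : Set (W p A)) := by
  let _ : ∀ n, TopologicalSpace (Wn p A n) := fun _ => ⊥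
  intro w
  refine mem_closure_iff.2 fun U hU hw => ?_
  obtain ⟨O, hO, rfl⟩ := isOpen_induced_iff.1 hU
  obtain ⟨s, u, hu, hsub⟩ := isOpen_pi_iff.1 hO _ hw
  -- `s.sup id` bounds all the indices that the basic neighbourhood constrains.
  obtain ⟨w', hw', h⟩ := Wn.exists_mem_closure_single p (s.sup id) (w.1 (s.sup id))
  refine ⟨w', hsub fun i hi => ?_, hw'⟩
  exact (W.eq_of_le p h (Finset.le_sup (f := id) hi)).symm ▸ (hu i hi).2

end generators

/-! ### Reduction to commutative rings by naturality. -/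

/-- A continuous functional on `HH₀(E(A))` that kills all `V ^ n ⟨a⟩` kills the image of every
natural transformation as in the theorem. -/
theorem comp_eq_zero_of_natural (p : ℕ) [Fact p.Prime]
    (φ : ∀ (A : Type u) [Ring A], W p A →+ HH0E p A)
    (hnat : ∀ (A B : Type u) [Ring A] [Ring B] (f : A →+* B) (x : W p A),
      φ B (W.map p f x) = HH0E.map p f (φ A x))
    (hcont : ∀ (A : Type u) [Ring A], Continuous (φ A))
    (hcomm : ∀ (A : Type u) [CommRing A] (a : ℕ → A),
      HasSum (fun n : ℕ => (QuotientAddGroup.mk ((E.V p A)^[n] (E.teich p (a n))) : HH0E p A))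
        (φ A (W.mk p a)))
    {A : Type u} [Ring A] {M : Type*} [AddCommGroup M] [TopologicalSpace M] [T2Space M]
    (ψ : HH0E p A →+ M) (hψ : Continuous ψ)
    (hV : ∀ n a, ψ (QuotientAddGroup.mk ((E.V p A)^[n] (E.teich p a))) = 0) (w : W p A) :
    ψ (φ A w) = 0 := by
  have hsingle : ∀ i (a : A), ψ (φ A (W.mk p (Pi.single i a))) = 0 := by
    intro i a
    -- A single element is the image of the variable of a commutative polynomial ring, even if A is
    -- noncommutative. `ULift` places this ring in the universe of A.
    let f : Polynomial (ULift.{u} ℤ) →+* A :=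
      Polynomial.eval₂RingHom' ((Int.castRingHom A).comp ULift.ringEquiv.toRingHom) a
        fun n => Int.cast_commute _ _
    have hf : f Polynomial.X = a := Polynomial.eval₂_X _ _
    have hmk : W.mk p (Pi.single i a) =
        W.map p f (W.mk p (Pi.single i (Polynomial.X : Polynomial (ULift.{u} ℤ)))) := by
      rw [W.map_mk]
      congr 1
      funext j
      rw [Pi.apply_single (fun _ => f) (fun _ => map_zero f), hf]
    rw [hmk, hnat]
    have hs := (hcomm (Polynomial (ULift.{u} ℤ)) (Pi.single i Polynomial.X)).map
      (ψ.comp (HH0E.map p f)) (hψ.comp (HH0E.continuous_map p f))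
    refine hs.unique ?_
    -- After applying f, every term of the series is again some V^n⟨b⟩ with b in A, so ψ kills it;
    -- limits in M are unique.
    convert hasSum_zero with n
    change ψ (QuotientAddGroup.mk (E.map p f _)) = 0
    rw [E.map_iterate_V, E.map_teich, hV]
  have hc : IsClosed {w | ψ (φ A w) = 0} := isClosed_eq (hψ.comp (hcont A)) continuous_const
  refine closure_minimal (fun y hy => ?_) hc (W.dense_closure_single p w)
  have h : AddSubgroup.closure (Set.range fun t : ℕ × A => (W.mk p (Pi.single t.1 t.2) : W p A)) ≤
      (ψ.comp (φ A)).ker := by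
    refine (AddSubgroup.closure_le _).2 ?_
    rintro _ ⟨⟨i, a⟩, rfl⟩
    exact hsingle i a
  exact h hy

/-! ### The ring of `2 × 2` matrices over `𝔽_p` -/

/-- The trace of a `2 × 2` matrix over `𝔽_p`. -/
def matrixTrace (p : ℕ) : ULift.{u} (Matrix (Fin 2) (Fin 2) (ZMod p)) →+ ZMod p :=
  (Matrix.traceAddMonoidHom (Fin 2) (ZMod p)).comp
    (ULift.ringEquiv (R := Matrix (Fin 2) (Fin 2) (ZMod p))).toRingHom.toAddMonoidHom

theorem matrixTrace_apply (p : ℕ) (a : ULift.{u} (Matrix (Fin 2) (Fin 2) (ZMod p))) :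
    matrixTrace p a = a.down.trace := rfl

theorem matrixTrace_mul_comm (p : ℕ) (a b : ULift.{u} (Matrix (Fin 2) (Fin 2) (ZMod p))) :
    matrixTrace p (a * b) = matrixTrace p (b * a) :=
  Matrix.trace_mul_comm a.down b.down

theorem matrixTrace_p_mul (p : ℕ) (a : ULift.{u} (Matrix (Fin 2) (Fin 2) (ZMod p))) :
    matrixTrace p (p * a) = 0 := by
  rw [← nsmul_eq_mul, map_nsmul, nsmul_eq_mul, CharP.cast_eq_zero, zero_mul]

/-- In characteristic p the trace satisfies tr(a^p) = tr(a)^p, and Frobenius is the identity on 𝔽_p.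
-/
theorem matrixTrace_pow (p : ℕ) [Fact p.Prime]
    (a : ULift.{u} (Matrix (Fin 2) (Fin 2) (ZMod p))) : matrixTrace p (a ^ p) = matrixTrace p a := by
  rw [matrixTrace_apply, matrixTrace_apply, ULift.pow_down, ZMod.trace_pow_card, ZMod.pow_card]

end NCWitt

/-- There is no family of homomorphisms `φ_A : W(A) → HH₀(E(A))`, natural in the unital ring `A`,
all of them continuous and surjective, which for commutative `A` is the natural isomorphism
`(a₀, a₁, …) ↦ ∑ₙ Vⁿ⟨aₙ⟩`. -/
theorem mainTheorem3 (p : ℕ) [Fact p.Prime] :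
    ¬ ∃ φ : ∀ (A : Type u) [Ring A], NCWitt.W p A →+ NCWitt.HH0E p A,
      (∀ (A B : Type u) [Ring A] [Ring B] (f : A →+* B) (x : NCWitt.W p A),
        φ B (NCWitt.W.map p f x) = NCWitt.HH0E.map p f (φ A x)) ∧
      (∀ (A : Type u) [Ring A], Continuous (φ A)) ∧
      (∀ (A : Type u) [Ring A], Function.Surjective (φ A)) ∧
      (∀ (A : Type u) [CommRing A] (a : ℕ → A),
        HasSum (fun n : ℕ => (QuotientAddGroup.mk ((NCWitt.E.V p A)^[n] (NCWitt.E.teich p (a n))) :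
          NCWitt.HH0E p A)) (φ A (NCWitt.W.mk p a))) := by
  rintro ⟨φ, hnat, hcont, hsurj, hcomm⟩
  let _ : TopologicalSpace (ZMod p) := ⊥
  have : DiscreteTopology (ZMod p) := ⟨rfl⟩
  let τ := NCWitt.matrixTrace.{u} p
  let ψ := NCWitt.HH0E.traceDiff p τ (NCWitt.matrixTrace_mul_comm p)
  -- Both matrix units square to zero, so x^p y^p = 0, while xy is an idempotent of trace 1.
  let x : ULift.{u} (Matrix (Fin 2) (Fin 2) (ZMod p)) := ⟨Matrix.single 0 1 1⟩
  let y : ULift.{u} (Matrix (Fin 2) (Fin 2) (ZMod p)) := ⟨Matrix.single 1 0 1⟩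
  -- Surjectivity is needed only for the class of ⟨x⟩⟨y⟩.
  obtain ⟨w, hw⟩ := hsurj _
    (QuotientAddGroup.mk (NCWitt.E.teich p x * NCWitt.E.teich p y))
  have h0 : ψ (φ _ w) = 0 :=
    NCWitt.comp_eq_zero_of_natural p φ hnat hcont hcomm ψ
      (NCWitt.HH0E.continuous_traceDiff p τ _)
      (NCWitt.HH0E.traceDiff_V_teich p τ _ (NCWitt.matrixTrace_p_mul p)
        (NCWitt.matrixTrace_pow p)) w
  have hx : x ^ p = 0 := by
    refine pow_eq_zero_of_le (Fact.out : p.Prime).two_le (ULift.ext _ _ ?_)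
    rw [ULift.pow_down, pow_two]
    exact Matrix.single_mul_single_of_ne _ _ _ _ (by decide) _
  have hxy : τ (x * y) = 1 := by
    change (Matrix.single 0 1 1 * Matrix.single 1 0 1 : Matrix (Fin 2) (Fin 2) (ZMod p)).trace = 1
    rw [Matrix.single_mul_single_same, Matrix.trace_single_eq_same, mul_one]
  rw [hw, NCWitt.HH0E.traceDiff_mk, map_mul, NCWitt.E.toSeq_teich, NCWitt.E.toSeq_teich] at h0
  -- The left side is tr(x^p y^p) - tr(xy) = 0 - 1, which is nonzero in 𝔽_p.
  change τ (x ^ p ^ 1 * y ^ p ^ 1) - τ (x ^ p ^ 0 * y ^ p ^ 0) = 0 at h0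
  rw [pow_one, pow_zero, pow_one, pow_one, hx, zero_mul, map_zero, hxy] at h0
  exact one_ne_zero (neg_eq_zero.1 ((zero_sub (1 : ZMod p)).symm.trans h0))
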